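/- Let $m$ be a natural number, let $W\in C^1(\mathbb{R}^m,\mathbb{R})$, and let $u\in C^2(\mathbb{R}^2,\mathbb{R}^m)$ be a bounded solution of $\Delta u=\nabla W(u)$ in $\mathbb{R}^2$. Then there is a function $U\in C^3(\mathbb{R}^2,\mathbb{R})$ whose Hessian matrix is $$D^2U=\begin{pmatrix} |u_{x_1}|^2-|u_{x_2}|^2+2W(u) & 2\,u_{x_1}\cdot u_{x_2}\\ 2\,u_{x_1}\cdot u_{x_2} & |u_{x_2}|^2-|u_{x_1}|^2+2W(u)\end{pmatrix}. \qquad (\ast)$$ Moreover, for every $U\in C^3(\mathbb{R}^2,\mathbb{R})$ satisfying $(\ast)$, every solution $V\in C^2(\mathbb{R}^2,\mathbb{R})$ of the equation $\Delta V=4W(u)$ in $\mathbb{R}^2$ whose second derivatives are bounded can be written as $$V=U+\lambda(x_1^2-x_2^2)+\mu x_1x_2+\alpha x_1+\beta x_2+\gamma$$ for some real constants $\lambda,\mu,\alpha,\beta,\gamma$. -/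

import Mathlib

open scoped InnerProductSpace Laplacian Gradient

/-- The Euclidean plane `ℝ²`; the coordinates `x₁, x₂` of `x` are `x 0, x 1`. -/
abbrev Plane : Type := EuclideanSpace ℝ (Fin 2)

/-- The partial derivative `f_{x_i}` of a function on the plane. -/
noncomputable def partialDeriv {F : Type*} [NormedAddCommGroup F] [NormedSpace ℝ F]
    (i : Fin 2) (f : Plane → F) (x : Plane) : F :=
  fderiv ℝ f x (EuclideanSpace.single i 1)

/-- The matrix `D²f = (f_{x_i x_j})` of second partial derivatives of a real function. -/
noncomputable def hessianMatrix (f : Plane → ℝ) (x : Plane) : Matrix (Fin 2) (Fin 2) ℝ :=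
  Matrix.of fun i j => partialDeriv j (partialDeriv i f) x

/-- The symmetric matrix
`(|u_{x₁}|² - |u_{x₂}|² + 2W(u), 2 u_{x₁}·u_{x₂}; 2 u_{x₁}·u_{x₂}, |u_{x₂}|² - |u_{x₁}|² + 2W(u))`,
the alternative form of the stress-energy tensor of `u` in the plane. -/
noncomputable def planarStressTensor {m : ℕ} (W : EuclideanSpace ℝ (Fin m) → ℝ)
    (u : Plane → EuclideanSpace ℝ (Fin m)) (x : Plane) : Matrix (Fin 2) (Fin 2) ℝ :=
  !![‖partialDeriv 0 u x‖ ^ 2 - ‖partialDeriv 1 u x‖ ^ 2 + 2 * W (u x),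
      2 * ⟪partialDeriv 0 u x, partialDeriv 1 u x⟫_ℝ;
    2 * ⟪partialDeriv 0 u x, partialDeriv 1 u x⟫_ℝ,
      ‖partialDeriv 1 u x‖ ^ 2 - ‖partialDeriv 0 u x‖ ^ 2 + 2 * W (u x)]

/-- `U` is a function associated with `u`: it is of class `C³` and its Hessian matrix is the
planar stress tensor of `u`. -/
structure IsStressPotential {m : ℕ} (W : EuclideanSpace ℝ (Fin m) → ℝ)
    (u : Plane → EuclideanSpace ℝ (Fin m)) (U : Plane → ℝ) : Prop where
  contDiff : ContDiff ℝ 3 U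
  hessian_eq : ∀ x, hessianMatrix U x = planarStressTensor W u x

/-! Existence: by `Δu = ∇W(u)`, both rows of the stress tensor are closed 1-forms, and symmetry of
the tensor makes the pair of their primitives closed as well, so the Poincaré lemma applies twice.
Uniqueness: the tensor has trace `4W(u)`, so `h = V - U` is harmonic. No pointwise bound on `∇u` is
needed: a Caccioppoli estimate (`exists_integral_energy_le`) bounds the local energy of `u`
uniformly over translations, hence also the second derivatives of `h` in `L¹` on unit scale. Since
`h₁₁ - i h₁₂` is entire, the mean value property turns this into a sup bound, and Liouville makes it
constant (`exists_quadratic_of_harmonic`). -/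

theorem ContDiff.partialDeriv {F : Type*} [NormedAddCommGroup F] [NormedSpace ℝ F]
    {f : Plane → F} {n k : WithTop ℕ∞} (hf : ContDiff ℝ k f) (hk : n + 1 ≤ k) (i : Fin 2) :
    ContDiff ℝ n (partialDeriv i f) :=
  (hf.fderiv_right hk).clm_apply contDiff_const

theorem fderiv_plane_apply {F : Type*} [NormedAddCommGroup F] [NormedSpace ℝ F]
    (f : Plane → F) (x v : Plane) :
    fderiv ℝ f x v = v 0 • partialDeriv 0 f x + v 1 • partialDeriv 1 f x := by
  have hv : v = v 0 • EuclideanSpace.single 0 (1 : ℝ) + v 1 • EuclideanSpace.single 1 (1 : ℝ) := by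
    ext i; fin_cases i <;> simp
  conv_lhs => rw [hv]
  simp [partialDeriv]

theorem partialDeriv_partialDeriv {F : Type*} [NormedAddCommGroup F] [NormedSpace ℝ F]
    {f : Plane → F} (hf : ContDiff ℝ 2 f) (i j : Fin 2) (x : Plane) :
    partialDeriv j (partialDeriv i f) x =
      fderiv ℝ (fderiv ℝ f) x (EuclideanSpace.single j 1) (EuclideanSpace.single i 1) := by
  have h : DifferentiableAt ℝ (fderiv ℝ f) x :=
    ((hf.fderiv_right (m := 1) (by norm_num)).differentiable (by norm_num)) x
  unfold partialDeriv
  rw [fderiv_clm_apply h (by fun_prop)]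
  simp

theorem partialDeriv_comm {F : Type*} [NormedAddCommGroup F] [NormedSpace ℝ F]
    {f : Plane → F} (hf : ContDiff ℝ 2 f) (i j : Fin 2) (x : Plane) :
    partialDeriv j (partialDeriv i f) x = partialDeriv i (partialDeriv j f) x := by
  rw [partialDeriv_partialDeriv hf, partialDeriv_partialDeriv hf]
  exact (hf.contDiffAt.isSymmSndFDerivAt (by simp)) _ _

theorem laplacian_plane {F : Type*} [NormedAddCommGroup F] [NormedSpace ℝ F]
    {f : Plane → F} (hf : ContDiff ℝ 2 f) (x : Plane) :
    (Δ f) x = partialDeriv 0 (partialDeriv 0 f) x + partialDeriv 1 (partialDeriv 1 f) x := by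
  rw [InnerProductSpace.laplacian_eq_iteratedFDeriv_orthonormalBasis f
    (EuclideanSpace.basisFun (Fin 2) ℝ)]
  simp [iteratedFDeriv_two_apply, partialDeriv_partialDeriv hf]

theorem HasFDerivAt.partialDeriv_eq {F : Type*} [NormedAddCommGroup F] [NormedSpace ℝ F]
    {f : Plane → F} {f' : Plane →L[ℝ] F} {x : Plane} (h : HasFDerivAt f f' x) (i : Fin 2) :
    partialDeriv i f x = f' (EuclideanSpace.single i 1) := by
  rw [partialDeriv, h.fderiv]

theorem partialDeriv_sub {F : Type*} [NormedAddCommGroup F] [NormedSpace ℝ F] {f g : Plane → F}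
    (hf : Differentiable ℝ f) (hg : Differentiable ℝ g) (i : Fin 2) :
    partialDeriv i (fun x => f x - g x) = fun x => partialDeriv i f x - partialDeriv i g x := by
  ext x
  exact ((hf x).hasFDerivAt.sub (hg x).hasFDerivAt).partialDeriv_eq i

/-! ### Existence of the potential. -/

/-- The Poincaré lemma for 1-forms `P dx₁ + Q dx₂` on the plane. -/
theorem exists_partialDeriv_eq {n : ℕ} {P Q : Plane → ℝ} (hn : 1 ≤ n) (hP : ContDiff ℝ n P)
    (hQ : ContDiff ℝ n Q) (h : ∀ x, partialDeriv 1 P x = partialDeriv 0 Q x) :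
    ∃ f : Plane → ℝ, ContDiff ℝ (n + 1) f ∧ partialDeriv 0 f = P ∧ partialDeriv 1 f = Q := by
  let e : Fin 2 → (Plane →L[ℝ] ℝ) := fun i => EuclideanSpace.proj i
  let ω : Plane → (Plane →L[ℝ] ℝ) := fun x => P x • e 0 + Q x • e 1
  have hω : ContDiff ℝ n ω := (hP.smul contDiff_const).add (hQ.smul contDiff_const)
  have hn0 : (n : WithTop ℕ∞) ≠ 0 := by exact_mod_cast (by omega : n ≠ 0)
  have hPd := hP.differentiable hn0
  have hQd := hQ.differentiable hn0
  have hd : ∀ x, HasFDerivAt ω ((fderiv ℝ P x).smulRight (e 0) + (fderiv ℝ Q x).smulRight (e 1)) x :=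
    fun x => ((hPd x).hasFDerivAt.smul_const (e 0)).add ((hQd x).hasFDerivAt.smul_const (e 1))
  obtain ⟨f, hf⟩ := convex_univ.exists_forall_hasFDerivAt_of_fderiv_symmetric isOpen_univ
    (hω.differentiable hn0).differentiableOn (fun a _ x y => by
      rw [(hd a).fderiv]
      simp [fderiv_plane_apply, h, e]
      ring)
  refine ⟨f, ?_, ?_, ?_⟩
  · rw [contDiff_succ_iff_hasFDerivAt]
    exact ⟨ω, hω, fun x => hf x trivial⟩
  all_goals
    ext x
    rw [(hf x trivial).partialDeriv_eq]
    simp [ω, e]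

theorem exists_isStressPotential {m : ℕ} {W : EuclideanSpace ℝ (Fin m) → ℝ} (hW : ContDiff ℝ 1 W)
    {u : Plane → EuclideanSpace ℝ (Fin m)} (hu : ContDiff ℝ 2 u)
    (hsol : ∀ x, (Δ u) x = (∇ W) (u x)) :
    ∃ U : Plane → ℝ, IsStressPotential W u U := by
  have hp : ∀ i, ContDiff ℝ 1 (partialDeriv i u) := hu.partialDeriv (by norm_num)
  have hpd : ∀ i x, HasFDerivAt (partialDeriv i u) (fderiv ℝ (partialDeriv i u) x) x :=
    fun i x => ((hp i).differentiable (by norm_num) x).hasFDerivAt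
  have hWu : ContDiff ℝ 1 (fun x => W (u x)) := hW.comp (hu.of_le (by norm_num))
  have hn : ∀ i x, HasFDerivAt (fun x => ‖partialDeriv i u x‖ ^ 2) _ x :=
    fun i x => (hpd i x).norm_sq
  have hin : ∀ x, HasFDerivAt (fun x => ⟪partialDeriv 0 u x, partialDeriv 1 u x⟫_ℝ) _ x :=
    fun x => (hpd 0 x).inner ℝ (hpd 1 x)
  have hw : ∀ x, HasFDerivAt (fun x => W (u x)) _ x := fun x =>
    HasFDerivAt.comp x (hW.differentiable (by norm_num) (u x)).hasGradientAt.hasFDerivAt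
      (hu.differentiable (by norm_num) x).hasFDerivAt
  have hpp : ∀ i j x, fderiv ℝ (partialDeriv i u) x (EuclideanSpace.single j 1) =
    partialDeriv j (partialDeriv i u) x := fun _ _ _ => rfl
  have hp1 : ∀ i x, fderiv ℝ u x (EuclideanSpace.single i 1) = partialDeriv i u x :=
    fun _ _ => rfl
  let a : Plane → ℝ := fun x =>
    ‖partialDeriv 0 u x‖ ^ 2 - ‖partialDeriv 1 u x‖ ^ 2 + 2 * W (u x)
  let b : Plane → ℝ := fun x => 2 * ⟪partialDeriv 0 u x, partialDeriv 1 u x⟫_ℝ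
  let c : Plane → ℝ := fun x =>
    ‖partialDeriv 1 u x‖ ^ 2 - ‖partialDeriv 0 u x‖ ^ 2 + 2 * W (u x)
  have ha : ContDiff ℝ 1 a :=
    (((hp 0).norm_sq ℝ).sub ((hp 1).norm_sq ℝ)).add (contDiff_const.mul hWu)
  have hb : ContDiff ℝ 1 b := contDiff_const.mul ((hp 0).inner ℝ (hp 1))
  have hc : ContDiff ℝ 1 c :=
    (((hp 1).norm_sq ℝ).sub ((hp 0).norm_sq ℝ)).add (contDiff_const.mul hWu)
  -- `a₂ = 2u₁·u₁₂ - 2u₂·u₂₂ + 2∇W(u)·u₂`; substituting `∇W(u) = u₁₁ + u₂₂` leaves `2u₁·u₁₂ +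
  -- 2u₂·u₁₁ = b₁`.
  have hab : ∀ x, partialDeriv 1 a x = partialDeriv 0 b x := by
    intro x
    have h1 := (((hn 0 x).sub (hn 1 x)).add ((hw x).const_mul 2)).partialDeriv_eq 1
    have h2 := ((hin x).const_mul 2).partialDeriv_eq 0
    refine (h1.trans ?_).trans h2.symm
    simp [hpp, hp1, ← hsol, laplacian_plane hu, partialDeriv_comm hu 1 0,
      real_inner_comm]
    ring
  have hbc : ∀ x, partialDeriv 1 b x = partialDeriv 0 c x := by
    intro x
    have h1 := (((hn 1 x).sub (hn 0 x)).add ((hw x).const_mul 2)).partialDeriv_eq 0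
    have h2 := ((hin x).const_mul 2).partialDeriv_eq 1
    refine (h2.trans ?_).trans h1.symm
    simp [hpp, hp1, ← hsol, laplacian_plane hu, partialDeriv_comm hu 1 0,
      real_inner_comm]
    ring
  obtain ⟨p, hp2, hp0, hp1⟩ := exists_partialDeriv_eq (n := 1) le_rfl ha hb hab
  obtain ⟨q, hq2, hq0, hq1⟩ := exists_partialDeriv_eq (n := 1) le_rfl hb hc hbc
  -- `p dx₁ + q dx₂` is closed because `p₂ = b = q₁`.
  obtain ⟨U, hU, hU0, hU1⟩ := exists_partialDeriv_eq (n := 2) (by norm_num)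
    (by norm_num at hp2 ⊢; exact hp2) (by norm_num at hq2 ⊢; exact hq2)
    (fun x => by rw [hp1, hq0])
  refine ⟨U, by norm_num at hU; exact hU, fun x => ?_⟩
  ext i j
  fin_cases i <;> fin_cases j <;>
    simp [hessianMatrix, planarStressTensor, hU0, hU1, hp0, hp1, hq0, hq1, a, b, c]

/-! ### Local energy estimate. -/

open MeasureTheory in
theorem integral_mul_partialDeriv_partialDeriv {η φ : Plane → ℝ} (hη : ContDiff ℝ 2 η)
    (hηc : HasCompactSupport η) (hφ : ContDiff ℝ 2 φ) (i : Fin 2) :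
    ∫ x, η x * partialDeriv i (partialDeriv i φ) x =
      ∫ x, partialDeriv i (partialDeriv i η) x * φ x := by
  have hη1 : ContDiff ℝ 1 (partialDeriv i η) := hη.partialDeriv (by norm_num) i
  have hφ1 : ContDiff ℝ 1 (partialDeriv i φ) := hφ.partialDeriv (by norm_num) i
  have hη2 : ContDiff ℝ 0 (partialDeriv i (partialDeriv i η)) := hη1.partialDeriv (by norm_num) i
  have hφ2 : ContDiff ℝ 0 (partialDeriv i (partialDeriv i φ)) := hφ1.partialDeriv (by norm_num) i
  have hc1 : HasCompactSupport (partialDeriv i η) := hηc.fderiv_apply ℝ _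
  have hc2 : HasCompactSupport (partialDeriv i (partialDeriv i η)) := hc1.fderiv_apply ℝ _
  have key : ∀ f g : Plane → ℝ, Continuous f → Continuous g → HasCompactSupport f →
      Integrable (fun x => f x * g x) :=
    fun f g hf hg hfc => (hf.mul hg).integrable_of_hasCompactSupport hfc.mul_right
  have h1 := integral_mul_fderiv_eq_neg_fderiv_mul_of_integrable (μ := volume) (f := η)
    (g := partialDeriv i φ) (v := EuclideanSpace.single i 1)
    (key _ _ hη1.continuous hφ1.continuous hc1) (key _ _ hη.continuous hφ2.continuous hηc)
    (key _ _ hη.continuous hφ1.continuous hηc)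
    (fun x _ => hη.differentiable (by norm_num) x) (fun x _ => hφ1.differentiable (by norm_num) x)
  have h2 := integral_mul_fderiv_eq_neg_fderiv_mul_of_integrable (μ := volume)
    (f := partialDeriv i η) (g := φ) (v := EuclideanSpace.single i 1)
    (key _ _ hη2.continuous hφ.continuous hc2) (key _ _ hη1.continuous hφ1.continuous hc1)
    (key _ _ hη1.continuous hφ.continuous hc1)
    (fun x _ => hη1.differentiable (by norm_num) x) (fun x _ => hφ.differentiable (by norm_num) x)
  change _ = -∫ x, partialDeriv i η x * partialDeriv i φ x at h1
  change ∫ x, partialDeriv i η x * partialDeriv i φ x = _ at h2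
  rw [h2, neg_neg] at h1
  exact h1

theorem partialDeriv_partialDeriv_norm_sq {E : Type*} [NormedAddCommGroup E]
    [InnerProductSpace ℝ E] {u : Plane → E} (hu : ContDiff ℝ 2 u) (i : Fin 2) (x : Plane) :
    partialDeriv i (partialDeriv i (fun x => ‖u x‖ ^ 2)) x =
      2 * ‖partialDeriv i u x‖ ^ 2 + 2 * ⟪u x, partialDeriv i (partialDeriv i u) x⟫_ℝ := by
  have hu1 : ContDiff ℝ 1 (partialDeriv i u) := hu.partialDeriv (by norm_num) i
  have hd : ∀ x, HasFDerivAt u (fderiv ℝ u x) x :=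
    fun x => (hu.differentiable (by norm_num) x).hasFDerivAt
  have h1 : partialDeriv i (fun x => ‖u x‖ ^ 2) = fun x => 2 * ⟪u x, partialDeriv i u x⟫_ℝ := by
    ext x
    rw [(hd x).norm_sq.partialDeriv_eq]
    simp [partialDeriv]
  rw [h1, (((hd x).inner ℝ (hu1.differentiable (by norm_num) x).hasFDerivAt).const_mul
    2).partialDeriv_eq]
  change 2 * (⟪u x, partialDeriv i (partialDeriv i u) x⟫_ℝ +
    ⟪partialDeriv i u x, partialDeriv i u x⟫_ℝ) = _
  rw [real_inner_self_eq_norm_sq]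
  ring

open MeasureTheory in
/-- A Caccioppoli-type estimate: the energy of a bounded function with bounded Laplacian is bounded
on the support of a cutoff function, uniformly over all such functions. -/
theorem exists_integral_energy_le {E : Type*} [NormedAddCommGroup E] [InnerProductSpace ℝ E]
    {η : Plane → ℝ} (hη : ContDiff ℝ 2 η) (hηc : HasCompactSupport η) (hη0 : ∀ x, 0 ≤ η x)
    (M L : ℝ) : ∃ K : ℝ, ∀ u : Plane → E, ContDiff ℝ 2 u → (∀ x, ‖u x‖ ≤ M) →
      (∀ x, ‖(Δ u) x‖ ≤ L) →
      ∫ x, η x * (‖partialDeriv 0 u x‖ ^ 2 + ‖partialDeriv 1 u x‖ ^ 2) ≤ K := by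
  let D : Fin 2 → Plane → ℝ := fun i => partialDeriv i (partialDeriv i η)
  have hDc : ∀ i, HasCompactSupport (D i) := fun i => (hηc.fderiv_apply ℝ _).fderiv_apply ℝ _
  have hD : ∀ i, Continuous (D i) := fun i =>
    ((hη.partialDeriv (n := 1) (by norm_num) i).partialDeriv (n := 0) (by norm_num) i).continuous
  -- From `Δ|u|² = 2|∇u|² + 2u·Δu`: moving the Laplacian of `|u|²` onto `η` leaves only quantities
  -- controlled by `M` and `L`.
  refine ⟨(∫ x, |D 0 x| * M ^ 2 + |D 1 x| * M ^ 2 + η x * (2 * (M * L))) / 2,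
    fun u hu hM hL => ?_⟩
  have hu1 : ∀ i, ContDiff ℝ 1 (partialDeriv i u) := fun i => hu.partialDeriv (by norm_num) i
  have hu2 : ∀ i, Continuous (partialDeriv i (partialDeriv i u)) := fun i =>
    ((hu1 i).partialDeriv (n := 0) (by norm_num) i).continuous
  let φ : Plane → ℝ := fun x => ‖u x‖ ^ 2
  have hφ : ContDiff ℝ 2 φ := hu.norm_sq ℝ
  have hφ2 : ∀ i, Continuous (partialDeriv i (partialDeriv i φ)) := fun i =>
    ((hφ.partialDeriv (n := 1) (by norm_num) i).partialDeriv (n := 0) (by norm_num) i).continuous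
  have key : ∀ f g : Plane → ℝ, Continuous f → Continuous g → HasCompactSupport f →
      Integrable (fun x => f x * g x) :=
    fun f g hf hg hfc => (hf.mul hg).integrable_of_hasCompactSupport hfc.mul_right
  have hΔ : Continuous (fun x => ⟪u x, (Δ u) x⟫_ℝ) := by
    simp_rw [laplacian_plane hu]
    exact hu.continuous.inner ((hu2 0).add (hu2 1))
  have i1 := fun i => key _ _ hη.continuous (hφ2 i) hηc
  have i2 := fun i => key _ _ (hD i) hφ.continuous (hDc i)
  have i3 := key _ (fun x => 2 * ⟪u x, (Δ u) x⟫_ℝ) hη.continuous (hΔ.const_mul 2) hηc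
  have i1s : Integrable fun x => η x * partialDeriv 0 (partialDeriv 0 φ) x +
      η x * partialDeriv 1 (partialDeriv 1 φ) x := (i1 0).add (i1 1)
  have i2s : Integrable fun x => D 0 x * φ x + D 1 x * φ x := (i2 0).add (i2 1)
  have e1 : ∀ x, η x * (‖partialDeriv 0 u x‖ ^ 2 + ‖partialDeriv 1 u x‖ ^ 2) =
      (η x * partialDeriv 0 (partialDeriv 0 φ) x + η x * partialDeriv 1 (partialDeriv 1 φ) x
        - η x * (2 * ⟪u x, (Δ u) x⟫_ℝ)) / 2 := by
    intro x
    rw [partialDeriv_partialDeriv_norm_sq hu, partialDeriv_partialDeriv_norm_sq hu,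
      laplacian_plane hu, inner_add_right]
    ring
  simp_rw [e1]
  rw [integral_div, integral_sub i1s i3, integral_add (i1 0) (i1 1),
    integral_mul_partialDeriv_partialDeriv hη hηc hφ,
    integral_mul_partialDeriv_partialDeriv hη hηc hφ, ← integral_add (i2 0) (i2 1),
    ← integral_sub i2s i3]
  refine div_le_div_of_nonneg_right (integral_mono (i2s.sub i3) ?_ fun x => ?_) zero_le_two
  · exact (((key _ _ (hD 0).abs continuous_const (hDc 0).abs)).add
      (key _ _ (hD 1).abs continuous_const (hDc 1).abs)).add
      (key _ _ hη.continuous continuous_const hηc)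
  · have hx : φ x ≤ M ^ 2 := pow_le_pow_left₀ (norm_nonneg _) (hM x) 2
    have hin : |⟪u x, (Δ u) x⟫_ℝ| ≤ M * L := (abs_real_inner_le_norm _ _).trans
      (mul_le_mul (hM x) (hL x) (norm_nonneg _) ((norm_nonneg _).trans (hM x)))
    have hb : ∀ i, D i x * φ x ≤ |D i x| * M ^ 2 := fun i =>
      mul_le_mul (le_abs_self _) hx (sq_nonneg _) (abs_nonneg _)
    have hc : -(η x * (2 * ⟪u x, (Δ u) x⟫_ℝ)) ≤ η x * (2 * (M * L)) := by
      rw [← mul_neg]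
      exact mul_le_mul_of_nonneg_left (by linarith [(abs_le.1 hin).1]) (hη0 x)
    have := hb 0
    have := hb 1
    simp only [D] at *
    linarith

/-! ### Weighted mean value property. -/

open MeasureTheory Real in
/-- The mean value property of an entire function, weighted by a radial cutoff. -/
theorem Differentiable.integral_radial_smul {g : ℂ → ℂ} (hg : Differentiable ℂ g) {χ : ℝ → ℝ}
    (hχ : Continuous χ) {R : ℝ} (hR : ∀ r, R < r → χ r = 0) :
    ∫ z : ℂ, χ ‖z‖ • g z = (∫ r in Set.Ioi (0 : ℝ), r * χ r * (2 * π)) • g 0 := by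
  rw [← Complex.integral_comp_polarCoord_symm, polarCoord_target]
  have h0 : Set.EqOn (fun p : ℝ × ℝ => p.1 • (fun z : ℂ => χ ‖z‖ • g z) (Complex.polarCoord.symm p))
      (fun p => (p.1 * χ p.1) • g (circleMap 0 p.1 p.2)) (Set.Ioi 0 ×ˢ Set.Ioo (-π) π) := by
    rintro ⟨r, θ⟩ ⟨hr, -⟩
    have hr : 0 < r := hr
    simp [circleMap, Complex.polarCoord_symm_apply, abs_of_pos hr, mul_assoc, Complex.exp_mul_I]
  rw [setIntegral_congr_fun (measurableSet_Ioi.prod measurableSet_Ioo) h0, Measure.volume_eq_prod,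
    setIntegral_prod]
  · rw [← integral_smul_const]
    refine setIntegral_congr_fun measurableSet_Ioi fun r hr => ?_
    have hmean := (hg.diffContOnCl (s := Metric.ball 0 |r|)).circleAverage
    have hper : Function.Periodic (fun θ => g (circleMap 0 r θ)) (2 * π) :=
      fun θ => by simp [periodic_circleMap 0 r θ]
    have hint : ∫ θ in Set.Ioo (-π) π, g (circleMap 0 r θ) = (2 * π) • g 0 := by
      rw [← integral_Ioc_eq_integral_Ioo,
        ← intervalIntegral.integral_of_le (by linarith [pi_pos])]
      -- Polar coordinates use angles in `(-π, π)`, circle averages use `(0, 2π)`.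
      have := hper.intervalIntegral_add_eq (-π) 0
      rw [zero_add, show -π + 2 * π = π by ring] at this
      rw [this, ← hmean, circleAverage_def, smul_inv_smul₀ (by positivity)]
    simp only [integral_smul, hint, smul_smul]
  · have hcont : Continuous (fun p : ℝ × ℝ => (p.1 * χ p.1) • g (circleMap 0 p.1 p.2)) := by
      have := hg.continuous
      unfold circleMap
      fun_prop
    rw [← Measure.volume_eq_prod]
    refine IntegrableOn.of_forall_sdiff_eq_zero
      (hcont.continuousOn.integrableOn_compact (isCompact_Icc.prod isCompact_Icc :
        IsCompact (Set.Icc (0 : ℝ) R ×ˢ Set.Icc (-π) π)))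
      (measurableSet_Ioi.prod measurableSet_Ioo) ?_
    rintro ⟨r, θ⟩ ⟨⟨hr, hθ⟩, hn⟩
    have hrR : R < r := by
      by_contra hle
      exact hn ⟨⟨le_of_lt hr, not_lt.1 hle⟩, Set.Ioo_subset_Icc_self hθ⟩
    simp [hR r hrR]

open MeasureTheory in
theorem Differentiable.integral_mul_norm_ge {g : ℂ → ℂ} (hg : Differentiable ℂ g) {χ : ℝ → ℝ}
    (hχ : Continuous χ) {R : ℝ} (hR : ∀ r, R < r → χ r = 0) (hχ0 : ∀ r, 0 ≤ χ r) :
    (∫ z : ℂ, χ ‖z‖) * ‖g 0‖ ≤ ∫ z : ℂ, χ ‖z‖ * ‖g z‖ := by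
  -- The case `g = 1` identifies the radial constant with `∫ χ ‖z‖`.
  have h1 := (differentiable_const (1 : ℂ)).integral_radial_smul hχ hR
  rw [integral_smul_const, smul_left_inj one_ne_zero] at h1
  rw [h1]
  calc _ ≤ ‖(∫ r in Set.Ioi (0 : ℝ), r * χ r * (2 * Real.pi)) • g 0‖ := by
        rw [norm_smul]; gcongr; exact le_abs_self _
    _ ≤ ∫ z : ℂ, ‖χ ‖z‖ • g z‖ := by
        rw [← hg.integral_radial_smul hχ hR]; exact norm_integral_le_integral_norm _
    _ = _ := by simp [abs_of_nonneg (hχ0 _)]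

/-- The cutoff profile: its composition with the norm is smooth and compactly supported. -/
noncomputable def cutoffProfile (r : ℝ) : ℝ := Real.smoothTransition (2 - r ^ 2)

theorem continuous_cutoffProfile : Continuous cutoffProfile :=
  Real.smoothTransition.continuous.comp (by fun_prop)

theorem cutoffProfile_nonneg (r : ℝ) : 0 ≤ cutoffProfile r := Real.smoothTransition.nonneg _

theorem cutoffProfile_zero : cutoffProfile 0 = 1 :=
  Real.smoothTransition.one_of_one_le (by norm_num)

theorem cutoffProfile_eq_zero {r : ℝ} (hr : 2 < r) : cutoffProfile r = 0 :=
  Real.smoothTransition.zero_of_nonpos (by nlinarith)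

theorem hasCompactSupport_cutoffProfile_norm {E : Type*} [NormedAddCommGroup E] [ProperSpace E] :
    HasCompactSupport fun x : E => cutoffProfile ‖x‖ :=
  HasCompactSupport.intro (isCompact_closedBall 0 2) fun x hx =>
    cutoffProfile_eq_zero (by simpa using hx)

/-- The profile depends on the squared norm, which is smooth even at the origin. -/
theorem contDiff_cutoffProfile_norm {E : Type*} [NormedAddCommGroup E] [InnerProductSpace ℝ E]
    {n : ℕ∞} : ContDiff ℝ n fun x : E => cutoffProfile ‖x‖ :=
  Real.smoothTransition.contDiff.comp (contDiff_const.sub (contDiff_norm_sq ℝ))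

open MeasureTheory in
theorem integral_cutoffProfile_norm_pos : 0 < ∫ z : ℂ, cutoffProfile ‖z‖ :=
  (continuous_cutoffProfile.comp continuous_norm).integral_pos_of_hasCompactSupport_nonneg_nonzero
    hasCompactSupport_cutoffProfile_norm (fun z => cutoffProfile_nonneg ‖z‖) (x := 0)
    (by simp [cutoffProfile_zero])

/-! ### Liouville theorem for harmonic functions. -/

/-- The linear isometry `ℂ ≃ ℝ²`, `x₁ + i x₂ ↦ (x₁, x₂)`. -/
noncomputable abbrev complexToPlane : ℂ ≃ₗᵢ[ℝ] Plane := Complex.orthonormalBasisOneI.repr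

theorem complexToPlane_eq (z : ℂ) : complexToPlane z = !₂[z.re, z.im] := by
  ext i; fin_cases i <;> simp

/-- The complex derivative `f_{x₁} - i f_{x₂}` of a function on the plane. -/
noncomputable def complexGradient (f : Plane → ℝ) (z : ℂ) : ℂ :=
  partialDeriv 0 f (complexToPlane z) - Complex.I * partialDeriv 1 f (complexToPlane z)

/-- The Cauchy-Riemann equations for `f₁ - i f₂` are `Δf = 0` and the symmetry of mixed derivatives.
-/
theorem hasDerivAt_complexGradient {f : Plane → ℝ} (hf : ContDiff ℝ 2 f)
    (hΔ : ∀ x, (Δ f) x = 0) (z : ℂ) :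
    HasDerivAt (complexGradient f)
      (partialDeriv 0 (partialDeriv 0 f) (complexToPlane z)
        - Complex.I * partialDeriv 0 (partialDeriv 1 f) (complexToPlane z)) z := by
  have hd : ∀ i, HasFDerivAt (fun z : ℂ => ((partialDeriv i f (complexToPlane z) : ℝ) : ℂ))
      (Complex.ofRealCLM ∘L fderiv ℝ (partialDeriv i f) (complexToPlane z) ∘L
        (complexToPlane.toContinuousLinearEquiv : ℂ →L[ℝ] Plane)) z := fun i =>
    Complex.ofRealCLM.hasFDerivAt.comp z
      (((hf.partialDeriv (n := 1) (by norm_num) i).differentiable (by norm_num) _).hasFDerivAt.comp z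
        complexToPlane.toContinuousLinearEquiv.hasFDerivAt)
  rw [hasDerivAt_iff_hasFDerivAt]
  refine hasFDerivAt_of_restrictScalars ℝ ((hd 0).sub ((hd 1).const_mul Complex.I)) ?_
  have h0 := hΔ (complexToPlane z)
  rw [laplacian_plane hf, add_eq_zero_iff_eq_neg, complexToPlane_eq] at h0
  ext w
  simp only [fderiv_plane_apply, ContinuousLinearMap.coe_restrictScalars', sub_apply, smul_apply,
    ContinuousLinearMap.comp_apply, ContinuousLinearMap.toSpanSingleton_apply, smul_eq_mul,
    Complex.ofRealCLM_apply, ContinuousLinearEquiv.coe_coe,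
    LinearIsometryEquiv.coe_toContinuousLinearEquiv, partialDeriv_comm hf 0 1, complexToPlane_eq,
    h0]
  apply Complex.ext <;> simp <;> ring

theorem partialDeriv_comp_add {F : Type*} [NormedAddCommGroup F] [NormedSpace ℝ F]
    (f : Plane → F) (i : Fin 2) (a : Plane) :
    partialDeriv i (fun x => f (x + a)) = fun x => partialDeriv i f (x + a) := by
  ext x
  simp [partialDeriv, fderiv_comp_add_right]

/-- A function on the plane whose gradient is that of a polynomial `p(x₁²-x₂²)/2 - q x₁x₂ + r x₁ - s x₂`
differs from that polynomial by a constant. -/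
theorem exists_eq_of_partialDeriv_eq {f : Plane → ℝ} (hf : Differentiable ℝ f) {p q r s : ℝ}
    (h0 : ∀ x, partialDeriv 0 f x = p * x 0 - q * x 1 + r)
    (h1 : ∀ x, partialDeriv 1 f x = -(p * x 1 + q * x 0 + s)) :
    ∃ γ, ∀ x, f x = p / 2 * (x 0 ^ 2 - x 1 ^ 2) - q * (x 0 * x 1) + r * x 0 - s * x 1 + γ := by
  have hc : ∀ i : Fin 2, ∀ x : Plane, HasFDerivAt (fun x : Plane => x i)
      (EuclideanSpace.proj i : Plane →L[ℝ] ℝ) x :=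
    fun i x => (EuclideanSpace.proj i : Plane →L[ℝ] ℝ).hasFDerivAt
  have hd := fun x => (hf x).hasFDerivAt.sub
    ((((((hc 0 x).pow 2).sub ((hc 1 x).pow 2)).const_mul (p / 2)).sub
      (((hc 0 x).mul (hc 1 x)).const_mul q)).add ((hc 0 x).const_mul r) |>.sub
      ((hc 1 x).const_mul s))
  refine ⟨f 0, fun x => ?_⟩
  have := is_const_of_fderiv_eq_zero (𝕜 := ℝ) (fun x => (hd x).differentiableAt) (fun x => by
    rw [(hd x).fderiv]
    ext v
    simp [fderiv_plane_apply, h0, h1]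
    ring) x 0
  simp at this
  linarith

open MeasureTheory in
/-- A Liouville theorem: a harmonic function on the plane whose second derivatives are bounded in
`L¹` on unit scale is a quadratic polynomial. -/
theorem exists_quadratic_of_harmonic {f : Plane → ℝ} (hf : ContDiff ℝ 2 f)
    (hΔ : ∀ x, (Δ f) x = 0) {K : ℝ}
    (hK : ∀ a, ∫ x : Plane, cutoffProfile ‖x‖ * (|partialDeriv 0 (partialDeriv 0 f) (x + a)| +
      |partialDeriv 0 (partialDeriv 1 f) (x + a)|) ≤ K) :
    ∃ lam mu α β γ : ℝ, ∀ x : Plane,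
      f x = lam * (x 0 ^ 2 - x 1 ^ 2) + mu * (x 0 * x 1) + α * x 0 + β * x 1 + γ := by
  have hG := hasDerivAt_complexGradient hf hΔ
  have hGd : Differentiable ℂ (complexGradient f) := fun z => (hG z).differentiableAt
  let g : ℂ → ℂ := deriv (complexGradient f)
  have hg : Differentiable ℂ g := hGd.deriv
  have hcont : ∀ i j, Continuous (partialDeriv i (partialDeriv j f)) := fun i j =>
    ((hf.partialDeriv (n := 1) (by norm_num) j).partialDeriv (n := 0) (by norm_num) i).continuous
  -- The mean value inequality for `g` translated by `w`, with `‖g‖ ≤ |f₁₁| + |f₁₂|`.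
  have hbd : ∀ w, ‖g w‖ ≤ K / ∫ z : ℂ, cutoffProfile ‖z‖ := by
    intro w
    rw [le_div_iff₀' integral_cutoffProfile_norm_pos]
    have h1 := (hg.comp (differentiable_id.add_const w)).integral_mul_norm_ge
      continuous_cutoffProfile (fun r => cutoffProfile_eq_zero) cutoffProfile_nonneg
    simp only [Function.comp_apply, id, zero_add] at h1
    refine h1.trans (le_trans ?_ (hK (complexToPlane w)))
    rw [← complexToPlane.measurePreserving.integral_comp
      complexToPlane.toHomeomorph.measurableEmbedding]
    refine integral_mono ?_ ?_ fun z => ?_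
    · refine Continuous.integrable_of_hasCompactSupport ?_
        hasCompactSupport_cutoffProfile_norm.mul_right
      have := hg.continuous
      have := continuous_cutoffProfile
      fun_prop
    · have hs : HasCompactSupport fun z : ℂ => cutoffProfile ‖complexToPlane z‖ := by
        simpa using hasCompactSupport_cutoffProfile_norm (E := ℂ)
      refine Continuous.integrable_of_hasCompactSupport ?_ hs.mul_right
      have := hcont 0 0
      have := hcont 0 1
      have := continuous_cutoffProfile
      fun_prop
    · simp only [g, (hG _).deriv, map_add, LinearIsometryEquiv.norm_map]
      gcongr
      · exact cutoffProfile_nonneg _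
      · refine (norm_sub_le _ _).trans_eq ?_
        simp
  obtain ⟨k, hk⟩ := hg.exists_const_forall_eq_of_bounded
    (Metric.isBounded_range_iff.2 ⟨_, fun z w => (dist_le_norm_add_norm _ _).trans
      (add_le_add (hbd z) (hbd w))⟩)
  have hGk : ∀ z, complexGradient f z = k * z + complexGradient f 0 := by
    intro z
    have hd : ∀ z, HasDerivAt (fun z => complexGradient f z - k * z) 0 z := fun z => by
      have := (hGd z).hasDerivAt.sub ((hasDerivAt_id z).const_mul k)
      rwa [mul_one, show deriv (complexGradient f) z = k from hk z, sub_self] at this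
    have := is_const_of_deriv_eq_zero (fun z => (hd z).differentiableAt) (fun z => (hd z).deriv) z 0
    simp only [mul_zero, sub_zero] at this
    linear_combination this
  set b := complexGradient f 0
  -- Real and imaginary parts of `f₁ - i f₂ = k z + b`.
  have hp : ∀ x : Plane, partialDeriv 0 f x = k.re * x 0 - k.im * x 1 + b.re ∧
      partialDeriv 1 f x = -(k.re * x 1 + k.im * x 0 + b.im) := by
    intro x
    have h := hGk ⟨x 0, x 1⟩
    have hx : complexToPlane ⟨x 0, x 1⟩ = x := by
      ext i; fin_cases i <;> simp [complexToPlane_eq]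
    rw [complexGradient, hx] at h
    have hre := congrArg Complex.re h
    have him := congrArg Complex.im h
    simp at hre him
    exact ⟨by linarith, by linarith⟩
  obtain ⟨γ, hγ⟩ := exists_eq_of_partialDeriv_eq (hf.differentiable (by norm_num))
    (fun x => (hp x).1) (fun x => (hp x).2)
  exact ⟨k.re / 2, -k.im, b.re, -b.im, γ, fun x => by rw [hγ]; ring⟩

/-! ### Conclusion. -/

theorem exists_bound_comp {E F : Type*} [NormedAddCommGroup E] [ProperSpace E]
    [NormedAddCommGroup F] {g : E → F} (hg : Continuous g) {X : Type*} {u : X → E} {M : ℝ}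
    (hu : ∀ x, ‖u x‖ ≤ M) : ∃ B, ∀ x, ‖g (u x)‖ ≤ B := by
  obtain ⟨B, hB⟩ := (isCompact_closedBall (0 : E) M).exists_bound_of_continuousOn hg.continuousOn
  exact ⟨B, fun x => hB _ (by simpa using hu x)⟩

open MeasureTheory in
theorem mainTheorem10 (m : ℕ) (W : EuclideanSpace ℝ (Fin m) → ℝ) (hW : ContDiff ℝ 1 W)
    (u : Plane → EuclideanSpace ℝ (Fin m)) (hu : ContDiff ℝ 2 u)
    (hbdd : ∃ M : ℝ, ∀ x, ‖u x‖ ≤ M)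
    (hsol : ∀ x, (Δ u) x = (∇ W) (u x)) :
    (∃ U : Plane → ℝ, IsStressPotential W u U) ∧
    ∀ U : Plane → ℝ, IsStressPotential W u U →
      ∀ V : Plane → ℝ, ContDiff ℝ 2 V →
        (∀ x, (Δ V) x = 4 * W (u x)) →
        (∃ C : ℝ, ∀ x, ∀ i j : Fin 2, |hessianMatrix V x i j| ≤ C) →
        ∃ lam mu α β γ : ℝ, ∀ x : Plane,
          V x = U x + lam * (x 0 ^ 2 - x 1 ^ 2) + mu * (x 0 * x 1)
            + α * x 0 + β * x 1 + γ := by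
  refine ⟨exists_isStressPotential hW hu hsol, ?_⟩
  rintro U ⟨hU3, hUH⟩ V hV hΔV ⟨C, hC⟩
  have hU : ContDiff ℝ 2 U := hU3.of_le (by norm_num)
  obtain ⟨M, hM⟩ := hbdd
  obtain ⟨L, hL⟩ := exists_bound_comp
    ((InnerProductSpace.toDual ℝ _).symm.continuous.comp (hW.continuous_fderiv (by norm_num)) :
      Continuous (∇ W)) hM
  obtain ⟨B, hB⟩ := exists_bound_comp hW.continuous hM
  let η : Plane → ℝ := fun x => cutoffProfile ‖x‖
  have hη : ContDiff ℝ 2 η := contDiff_cutoffProfile_norm (n := 2)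
  have hηc : HasCompactSupport η := hasCompactSupport_cutoffProfile_norm
  obtain ⟨K, hK⟩ := exists_integral_energy_le (E := EuclideanSpace ℝ (Fin m)) hη hηc
    (fun x => cutoffProfile_nonneg ‖x‖) M L
  have hUij : ∀ x i j, partialDeriv j (partialDeriv i U) x = planarStressTensor W u x i j :=
    fun x i j => congrFun (congrFun (hUH x) i) j
  let h : Plane → ℝ := fun x => V x - U x
  have hh : ContDiff ℝ 2 h := hV.sub hU
  have hhij : ∀ x i j, partialDeriv j (partialDeriv i h) x =
      partialDeriv j (partialDeriv i V) x - planarStressTensor W u x i j := by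
    intro x i j
    have hi : partialDeriv i h = _ :=
      partialDeriv_sub (hV.differentiable (by norm_num)) (hU.differentiable (by norm_num)) i
    rw [hi, partialDeriv_sub ((hV.partialDeriv (n := 1) (by norm_num) i).differentiable (by norm_num))
      ((hU.partialDeriv (n := 1) (by norm_num) i).differentiable (by norm_num)), ← hUij]
  have hΔh : ∀ x, (Δ h) x = 0 := by
    intro x
    have := hΔV x
    rw [laplacian_plane hV] at this
    rw [laplacian_plane hh, hhij, hhij]
    simp [planarStressTensor]
    linarith
  let S : Plane → ℝ := fun x => ‖partialDeriv 0 u x‖ ^ 2 + ‖partialDeriv 1 u x‖ ^ 2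
  have hpu : ∀ i, Continuous (partialDeriv i u) := fun i =>
    (hu.partialDeriv (n := 1) (by norm_num) i).continuous
  have hS : Continuous S := ((hpu 0).norm.pow 2).add ((hpu 1).norm.pow 2)
  -- Each of the two tensor entries contributes one `S x`; only the diagonal one contributes `2 *
  -- B`.
  have hhess : ∀ x, |partialDeriv 0 (partialDeriv 0 h) x| + |partialDeriv 0 (partialDeriv 1 h) x| ≤
      2 * S x + (2 * C + 2 * B) := by
    intro x
    rw [hhij, hhij]
    have h00 : |partialDeriv 0 (partialDeriv 0 V) x| ≤ C := hC x 0 0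
    have h10 : |partialDeriv 0 (partialDeriv 1 V) x| ≤ C := hC x 1 0
    have hBx : |W (u x)| ≤ B := hB x
    have hin := abs_real_inner_le_norm (partialDeriv 0 u x) (partialDeriv 1 u x)
    have hxy := two_mul_le_add_sq ‖partialDeriv 0 u x‖ ‖partialDeriv 1 u x‖
    have hT0 : |planarStressTensor W u x 0 0| ≤ S x + 2 * B := by
      simp only [planarStressTensor, Matrix.of_apply, Matrix.cons_val', Matrix.cons_val_zero, S]
      rw [abs_le] at hBx ⊢
      constructor <;>
        linarith [sq_nonneg ‖partialDeriv 0 u x‖, sq_nonneg ‖partialDeriv 1 u x‖]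
    have hT1 : |planarStressTensor W u x 1 0| ≤ S x := by
      simp [planarStressTensor, abs_mul, S]
      linarith
    linarith [abs_sub (partialDeriv 0 (partialDeriv 0 V) x) (planarStressTensor W u x 0 0),
      abs_sub (partialDeriv 0 (partialDeriv 1 V) x) (planarStressTensor W u x 1 0)]
  have hKh : ∀ a, ∫ x : Plane, cutoffProfile ‖x‖ * (|partialDeriv 0 (partialDeriv 0 h) (x + a)| +
      |partialDeriv 0 (partialDeriv 1 h) (x + a)|) ≤ 2 * K + (∫ x, η x) * (2 * C + 2 * B) := by
    intro a
    have hua : ContDiff ℝ 2 fun x => u (x + a) := hu.comp (contDiff_id.add contDiff_const)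
    -- Translates of `u` obey the same bounds `M` and `L`, so one `K` serves every centre `a`.
    have hE := hK (fun x => u (x + a)) hua (fun x => hM _) (fun x => by
      simp only [laplacian_plane hua, partialDeriv_comp_add]
      rw [← laplacian_plane hu, hsol]
      exact hL _)
    simp only [partialDeriv_comp_add] at hE
    have hhc : ∀ i j, Continuous (partialDeriv i (partialDeriv j h)) := fun i j =>
      ((hh.partialDeriv (n := 1) (by norm_num) j).partialDeriv (n := 0) (by norm_num) i).continuous
    have hta : Continuous fun x : Plane => x + a := by fun_prop
    have i1 : Integrable fun x => η x * S (x + a) :=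
      (hη.continuous.mul (hS.comp hta)).integrable_of_hasCompactSupport hηc.mul_right
    have i2 : Integrable η := hη.continuous.integrable_of_hasCompactSupport hηc
    calc _ ≤ ∫ x, (2 * (η x * S (x + a)) + η x * (2 * C + 2 * B)) := by
          refine integral_mono ?_ ((i1.const_mul 2).add (i2.mul_const _)) fun x => ?_
          · exact (hη.continuous.mul (((hhc 0 0).comp hta).abs.add
              ((hhc 0 1).comp hta).abs)).integrable_of_hasCompactSupport hηc.mul_right
          · have := mul_le_mul_of_nonneg_left (hhess (x + a)) (cutoffProfile_nonneg ‖x‖)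
            simp only [η]
            linarith
      _ = 2 * (∫ x, η x * S (x + a)) + (∫ x, η x) * (2 * C + 2 * B) := by
          rw [integral_add (i1.const_mul 2) (i2.mul_const _), integral_const_mul,
            integral_mul_const]
      _ ≤ _ := by gcongr
  obtain ⟨lam, mu, α, β, γ, hq⟩ := exists_quadratic_of_harmonic hh hΔh hKh
  refine ⟨lam, mu, α, β, γ, fun x => ?_⟩
  have : V x - U x = _ := hq x
  linarith
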